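/- Let $N\ge 1$ and $p\ge 0$ be integers. Let $M$ be an $N\times N$ GUE matrix, that is, the unitarily invariant random complex Hermitian matrix $M=U\,\mathrm{diag}(x_1,\dots,x_N)\,U^*$, where $U$ is Haar distributed on $U(N)$ and independent of $(x_1,\dots,x_N)\in\mathbb{R}^N$, which has the joint density $$\frac{1}{\mathscr{Z}_N^{(H)}}\prod_{1\le j<k\le N}(x_j-x_k)^2\prod_{j=1}^N e^{-Nx_j^2/2},$$ with $\mathscr{Z}_N^{(H)}$ the normalisation constant. Write $\mathbb{E}_N^{(H)}$ for the expectation. For a partition $\lambda$ put $C_\lambda(n)=\prod_{j=1}^n\frac{(\lambda_j+n-j)!}{(n-j)!}$, and let $(N^{2p})$ be the partition with $2p$ parts equal to $N$. Put $$D_e(N)=\prod_{j=0}^{p-1}\frac{j!^2}{(m+j)!^2}\quad (N=2m),\qquad D_o(N)=(-1)^p\frac{m!}{(m+p)!}\prod_{j=0}^{p-1}\frac{j!^2}{(m+j)!^2}\quad (N=2m+1),$$ $$\gamma_p=\prod_{j=0}^{p-1}\frac{j!}{(p+j)!},\qquad \rho_{sc}(t)=\frac{1}{2\pi}\sqrt{4-t^2}.$$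 (1) For every $N\ge 1$ the random variable $\det M^{2p}$ is integrable and $$\mathbb{E}_N^{(H)}[\det M^{2p}]=\Big(-\frac{1}{2N}\Big)^{Np}C_{(N^{2p})}(2p)\times\begin{cases}D_e(N),& N\text{ even},\\ D_o(N),& N\text{ odd}.\end{cases}$$ (2) For fixed $p$, as $N\to\infty$, $$C_{(N^{2p})}(2p)D_e(N)=e^{-Np}(2N)^{Np+p^2}\gamma_p\Big[1+\frac{p}{6N}(4p^2+1)+O(N^{-2})\Big]\quad (N\text{ even}),$$ $$C_{(N^{2p})}(2p)D_o(N)=(-1)^pe^{-Np}(2N)^{Np+p^2}\gamma_p\Big[1+\frac{p}{3N}(2p^2-1)+O(N^{-2})\Big]\quad (N\text{ odd}).$$ (3) For fixed $p$, as $N\to\infty$ through all integers, $\mathbb{E}_N^{(H)}[\det M^{2p}]\sim e^{-Np}(2N)^{p^2}\gamma_p$, and the right-hand side equals the Brézin–Hikami expression $e^{-Np}e^{Npt^2/2}(2\pi N\rho_{sc}(t))^{p^2}\gamma_p$ at $t=0$. (4) More precisely, for fixed $p$, as $N\to\infty$, $$\mathbb{E}_N^{(H)}[\det M^{2p}]=e^{-Np}(2N)^{p^2}\gamma_p\times\begin{cases}1+\frac{p}{6N}(4p^2+1)+O(N^{-2}),&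 N\text{ even},\\ 1+\frac{p}{3N}(2p^2-1)+O(N^{-2}),& N\text{ odd}.\end{cases}$$ -/

import Mathlib

open MeasureTheory Filter Asymptotics Topology

noncomputable section

/-! ### The Gaussian unitary ensemble -/

/-- The unnormalised joint eigenvalue density
`∏_{j<k} (x_j - x_k)^2 ∏_j exp (-N x_j^2 / 2)` of the `N × N` GUE. -/
def gueWeight (N : ℕ) (x : Fin N → ℝ) : ℝ :=
  (∏ j : Fin N, ∏ k ∈ Finset.Ioi j, (x j - x k) ^ 2) *
    ∏ j : Fin N, Real.exp (-((N : ℝ) * x j ^ 2 / 2))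

/-- The normalisation constant `𝒵_N^{(H)}`. -/
def gueZ (N : ℕ) : ℝ := ∫ x : Fin N → ℝ, gueWeight N x

/-- The law on `ℝ^N` with density `p^{(H)}(x_1, …, x_N)`, the joint eigenvalue density of the
GUE. -/
def gueEigenvalueLaw (N : ℕ) : Measure (Fin N → ℝ) :=
  volume.withDensity fun x => ENNReal.ofReal (gueWeight N x / gueZ N)

instance unitaryGroupCompactSpace (N : ℕ) : CompactSpace (Matrix.unitaryGroup (Fin N) ℂ) := by
  refine (isCompact_iff_compactSpace
    (s := (Matrix.unitaryGroup (Fin N) ℂ : Set (Matrix (Fin N) (Fin N) ℂ)))).mp ?_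
  have hK : IsCompact (Set.univ.pi fun _ : Fin N => Set.univ.pi fun _ : Fin N =>
      Metric.closedBall (0 : ℂ) 1) :=
    isCompact_univ_pi fun _ => isCompact_univ_pi fun _ => isCompact_closedBall _ _
  refine IsCompact.of_isClosed_subset (X := Matrix (Fin N) (Fin N) ℂ) hK
    (isClosed_unitary (R := Matrix (Fin N) (Fin N) ℂ)) ?_
  intro U hU i _ j _
  simpa using entry_norm_bound_of_unitary hU i j

instance unitaryGroupMeasurableSpace (N : ℕ) :
    MeasurableSpace (Matrix.unitaryGroup (Fin N) ℂ) := borel _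

instance unitaryGroupBorelSpace (N : ℕ) : BorelSpace (Matrix.unitaryGroup (Fin N) ℂ) := ⟨rfl⟩

/-- Normalised Haar measure on the unitary group `U(N)`. -/
def unitaryHaar (N : ℕ) : Measure (Matrix.unitaryGroup (Fin N) ℂ) :=
  Measure.haarMeasure ⊤

/-- The sample space of the GUE: a Haar distributed unitary matrix `U`, and independently of it
real numbers `x_1, …, x_N` with joint density `p^{(H)}`. -/
def gueProb (N : ℕ) : Measure (Matrix.unitaryGroup (Fin N) ℂ × (Fin N → ℝ)) :=
  (unitaryHaar N).prod (gueEigenvalueLaw N)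

/-- The GUE matrix `M = U diag(x_1, …, x_N) U*`: its law is the unitarily invariant law on
`N × N` complex Hermitian matrices with joint eigenvalue density `p^{(H)}`. -/
def gueMatrix (N : ℕ) (ω : Matrix.unitaryGroup (Fin N) ℂ × (Fin N → ℝ)) :
    Matrix (Fin N) (Fin N) ℂ :=
  (ω.1 : Matrix (Fin N) (Fin N) ℂ) * Matrix.diagonal (fun i => ((ω.2 i : ℝ) : ℂ)) *
    star (ω.1 : Matrix (Fin N) (Fin N) ℂ)

/-- `𝔼_N^{(H)}[det M^k]`. -/
def gueDetMoment (N k : ℕ) : ℂ :=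
  ∫ ω, (gueMatrix N ω).det ^ k ∂(gueProb N)

/-! ### The constants -/

/-- `C_λ(n) = ∏_{j=1}^n (λ_j + n - j)! / (n - j)!` for a partition `λ = (λ_1, λ_2, …)`. -/
def Cpart (lam : ℕ → ℕ) (n : ℕ) : ℝ :=
  ∏ j ∈ Finset.Icc 1 n, ((lam j + n - j).factorial : ℝ) / ((n - j).factorial : ℝ)

/-- The rectangular partition `(N^k) = (N, …, N)` with `k` parts, indexed from `1`. -/
def rectPart (N k : ℕ) (j : ℕ) : ℕ := if 1 ≤ j ∧ j ≤ k then N else 0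

/-- `D_e(N) = ∏_{j=0}^{p-1} j!² / (m + j)!²`, where `N = 2m`. -/
def De (p N : ℕ) : ℝ :=
  ∏ j ∈ Finset.range p, (j.factorial : ℝ) ^ 2 / ((N / 2 + j).factorial : ℝ) ^ 2

/-- `D_o(N) = (-1)^p m! / (m + p)! ∏_{j=0}^{p-1} j!² / (m + j)!²`, where `N = 2m + 1`. -/
def Do (p N : ℕ) : ℝ :=
  (-1) ^ p * (((N / 2).factorial : ℝ) / ((N / 2 + p).factorial : ℝ)) *
    ∏ j ∈ Finset.range p, (j.factorial : ℝ) ^ 2 / ((N / 2 + j).factorial : ℝ) ^ 2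

/-- `γ_p = ∏_{j=0}^{p-1} j! / (p + j)!`. -/
def gammaConst (p : ℕ) : ℝ :=
  ∏ j ∈ Finset.range p, (j.factorial : ℝ) / ((p + j).factorial : ℝ)

/-- The Wigner semicircle density. -/
def rhoSC (x : ℝ) : ℝ := 1 / (2 * Real.pi) * Real.sqrt (4 - x ^ 2)

/-- The Brézin–Hikami expression
`e^{-Np} e^{Np t²/2} (2π N ρ_sc(t))^{p²} ∏_{j<p} j! / (p + j)!`. -/
def brezinHikami (p N : ℕ) (t : ℝ) : ℝ :=
  Real.exp (-((N : ℝ) * p)) * Real.exp ((N : ℝ) * p * t ^ 2 / 2) *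
    (2 * Real.pi * N * rhoSC t) ^ (p ^ 2) * gammaConst p

/-- `e^{-Np} (2N)^{p²} γ_p`. -/
def leadingTerm (p N : ℕ) : ℝ :=
  Real.exp (-((N : ℝ) * p)) * (2 * (N : ℝ)) ^ (p ^ 2) * gammaConst p

/-- `N → ∞` along even `N`. -/
def evenTop : Filter ℕ := atTop ⊓ 𝓟 {N | Even N}

/-- `N → ∞` along odd `N`. -/
def oddTop : Filter ℕ := atTop ⊓ 𝓟 {N | Odd N}

end

/-!
By unitary invariance `det M` is the product of the eigenvalues, so Andréief's identity turns
`𝔼[det M ^ k]` into a ratio of two `N × N` Hankel determinants, of the moments of the Gaussian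
weight shifted by `k` and unshifted. When `k = 2p` is even the odd entries of both matrices vanish
and each determinant splits into a block of even and a block of odd indices. Inside a block the
moments obey a Gamma-type recurrence `f (k + 1) = (a + k) b f k`, so the Hankel determinant is the
product of its first-column moments times a Vandermonde determinant that does not see `a`. In the
ratio only the products `∏_{i < n} f (i + p) / f i = ∏_{j < p} f (n + j) / f j` survive, so that
`𝔼[det M ^ (2p)]` is a product of `p` factors for every `N`.

For the asymptotics, each of these factors is compared with its leading order. Passing from index
`j` to `j + 1` multiplies the comparison by a rational function of `N` with expansion
`1 + 4 (j + 1) / N + O(N⁻²)`. The comparison for `j = 0` involves one Stirling factor and one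
central binomial coefficient, and it is there that the parity of `N` matters: its expansion starts
with `1 + 5 / (6 N)` for even and `1 + 1 / (3 N)` for odd `N`.
-/

noncomputable section

/-! ### Andréief's identity -/

section Andreief

variable {ι : Type*} [Fintype ι] [DecidableEq ι]

theorem det_mul_det_eq_sum_perm {R : Type*} [CommRing R] (A B : Matrix ι ι R) :
    A.det * B.det = ∑ τ : Equiv.Perm ι, ∑ σ : Equiv.Perm ι,
      ((Equiv.Perm.sign τ : ℤ) : R) * ((Equiv.Perm.sign σ : ℤ) : R) *
        ∏ j, A (τ j) j * B (σ j) j := by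
  rw [Matrix.det_apply', Matrix.det_apply', Finset.sum_mul_sum]
  refine Finset.sum_congr rfl fun τ _ => Finset.sum_congr rfl fun σ _ => ?_
  rw [Finset.prod_mul_distrib]
  ring

theorem sum_perm_sign_mul_sign_mul_prod {R : Type*} [CommRing R] (M : Matrix ι ι R) :
    ∑ τ : Equiv.Perm ι, ∑ σ : Equiv.Perm ι,
      ((Equiv.Perm.sign τ : ℤ) : R) * ((Equiv.Perm.sign σ : ℤ) : R) * ∏ j, M (τ j) (σ j) =
        (Fintype.card ι).factorial * M.det := by
  have inner_sum (τ : Equiv.Perm ι) : ∑ σ : Equiv.Perm ι,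
      ((Equiv.Perm.sign τ : ℤ) : R) * ((Equiv.Perm.sign σ : ℤ) : R) * ∏ j, M (τ j) (σ j) =
        M.det := by
    have sign_sq : ((Equiv.Perm.sign τ : ℤ) : R) * ((Equiv.Perm.sign τ : ℤ) : R) = 1 := by
      rw [← Int.cast_mul, Int.units_coe_mul_self, Int.cast_one]
    have det_columns := Matrix.det_permute' τ M.transpose
    rw [Matrix.det_apply', Matrix.det_transpose] at det_columns
    simp only [mul_assoc, ← Finset.mul_sum]
    calc ((Equiv.Perm.sign τ : ℤ) : R) * ∑ σ : Equiv.Perm ι,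
          ((Equiv.Perm.sign σ : ℤ) : R) * ∏ j, M (τ j) (σ j)
        = ((Equiv.Perm.sign τ : ℤ) : R) * (((Equiv.Perm.sign τ : ℤ) : R) * M.det) := by
          rw [← det_columns]; rfl
      _ = M.det := by rw [← mul_assoc, sign_sq, one_mul]
  simp only [inner_sum, Finset.sum_const, Finset.card_univ, Fintype.card_perm, nsmul_eq_mul]

variable {α 𝕜 : Type*} [MeasurableSpace α] [RCLike 𝕜] {μ : Measure α} [SigmaFinite μ]
  {f g : ι → α → 𝕜}

theorem integrable_det_mul_det (hfg : ∀ i j, Integrable (fun x => f i x * g j x) μ) :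
    Integrable (fun x : ι → α => (Matrix.of fun i j => f i (x j)).det *
      (Matrix.of fun i j => g i (x j)).det) (Measure.pi fun _ => μ) := by
  simp only [det_mul_det_eq_sum_perm, Matrix.of_apply]
  exact integrable_finsetSum _ fun τ _ => integrable_finsetSum _ fun σ _ =>
    (Integrable.fintype_prod fun j => hfg (τ j) (σ j)).const_mul _

theorem integral_det_mul_det (hfg : ∀ i j, Integrable (fun x => f i x * g j x) μ) :
    ∫ x : ι → α, (Matrix.of fun i j => f i (x j)).det * (Matrix.of fun i j => g i (x j)).det
        ∂(Measure.pi fun _ => μ) =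
      (Fintype.card ι).factorial * (Matrix.of fun i j => ∫ x, f i x * g j x ∂μ).det := by
  have integrable_term (τ σ : Equiv.Perm ι) : Integrable (fun x : ι → α =>
      ((Equiv.Perm.sign τ : ℤ) : 𝕜) * ((Equiv.Perm.sign σ : ℤ) : 𝕜) *
        ∏ j, f (τ j) (x j) * g (σ j) (x j)) (Measure.pi fun _ => μ) :=
    (Integrable.fintype_prod fun j => hfg (τ j) (σ j)).const_mul _
  simp only [det_mul_det_eq_sum_perm, Matrix.of_apply]
  rw [integral_finsetSum _ fun τ _ => integrable_finsetSum _ fun σ _ => integrable_term τ σ,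
    ← sum_perm_sign_mul_sign_mul_prod]
  refine Finset.sum_congr rfl fun τ _ => ?_
  rw [integral_finsetSum _ fun σ _ => integrable_term τ σ]
  refine Finset.sum_congr rfl fun σ _ => ?_
  rw [integral_const_mul,
    integral_fintype_prod_eq_prod (f := fun j y => f (τ j) y * g (σ j) y)]
  rfl

end Andreief

/-! ### Hankel determinants -/

section Hankel

/-- The `n × n` Hankel matrix `(m_{i+j})_{0 ≤ i, j < n}` of a sequence `m`. -/
def hankelMatrix {R : Type*} (n : ℕ) (m : ℕ → R) : Matrix (Fin n) (Fin n) R :=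
  Matrix.of fun i j => m (i + j)

theorem prod_sub_sq_mul_prod_eq_det_mul_det {R : Type*} [CommRing R] {n : ℕ} (w : R → R)
    (x : Fin n → R) :
    (∏ j, ∏ k ∈ Finset.Ioi j, (x j - x k) ^ 2) * ∏ j, w (x j) =
      (Matrix.of fun i j : Fin n => x j ^ (i : ℕ)).det *
        (Matrix.of fun i j : Fin n => x j ^ (i : ℕ) * w (x j)).det := by
  have det_powers : (Matrix.of fun i j : Fin n => x j ^ (i : ℕ)).det =
      ∏ j, ∏ k ∈ Finset.Ioi j, (x k - x j) := by
    rw [← Matrix.det_vandermonde, ← Matrix.det_transpose]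
    rfl
  have det_weighted := Matrix.det_mul_row (fun j => w (x j))
    (Matrix.of fun i j : Fin n => x j ^ (i : ℕ))
  simp only [Matrix.of_apply, mul_comm (w _)] at det_weighted
  have discriminant : ∏ j, ∏ k ∈ Finset.Ioi j, (x j - x k) ^ 2 =
      (∏ j, ∏ k ∈ Finset.Ioi j, (x k - x j)) ^ 2 := by
    simp only [← Finset.prod_pow]
    exact Finset.prod_congr rfl fun j _ => Finset.prod_congr rfl fun k _ => sub_sq_comm _ _
  rw [det_weighted, det_powers, discriminant]
  ring

variable {μ : Measure ℝ} [SigmaFinite μ] {w : ℝ → ℝ}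

theorem integrable_prod_sub_sq_mul_prod (n : ℕ)
    (hw : ∀ k : ℕ, Integrable (fun x => x ^ k * w x) μ) :
    Integrable (fun x : Fin n → ℝ => (∏ j, ∏ k ∈ Finset.Ioi j, (x j - x k) ^ 2) * ∏ j, w (x j))
      (Measure.pi fun _ => μ) := by
  simp only [prod_sub_sq_mul_prod_eq_det_mul_det]
  exact integrable_det_mul_det (f := fun (i : Fin n) x => x ^ (i : ℕ))
    (g := fun i x => x ^ (i : ℕ) * w x) fun i j => by
      simpa only [← mul_assoc, ← pow_add] using hw (i + j)

theorem integral_prod_sub_sq_mul_prod (n : ℕ)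
    (hw : ∀ k : ℕ, Integrable (fun x => x ^ k * w x) μ) :
    ∫ x : Fin n → ℝ, (∏ j, ∏ k ∈ Finset.Ioi j, (x j - x k) ^ 2) * ∏ j, w (x j)
        ∂(Measure.pi fun _ => μ) =
      n.factorial * (hankelMatrix n fun k => ∫ x, x ^ k * w x ∂μ).det := by
  simp only [prod_sub_sq_mul_prod_eq_det_mul_det]
  rw [integral_det_mul_det (f := fun (i : Fin n) x => x ^ (i : ℕ))
    (g := fun i x => x ^ (i : ℕ) * w x) fun i j => by
      simpa only [← mul_assoc, ← pow_add] using hw (i + j)]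
  simp only [Fintype.card_fin, ← mul_assoc, ← pow_add, hankelMatrix]

/-- The even elements of `Fin n`, in increasing order: the rows and columns of the first block of
a Hankel matrix whose odd entries vanish. -/
def finEvenEquiv (n : ℕ) : Fin ((n + 1) / 2) ≃ {i : Fin n // Even (i : ℕ)} where
  toFun i := ⟨⟨2 * i, by omega⟩, even_two_mul _⟩
  invFun i := ⟨(i.1 : ℕ) / 2, by omega⟩
  left_inv i := by ext; simp
  right_inv i := by
    ext
    exact Nat.two_mul_div_two_of_even i.2

/-- The odd elements of `Fin n`, in increasing order: the rows and columns of the second block of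
a Hankel matrix whose odd entries vanish. -/
def finOddEquiv (n : ℕ) : Fin (n / 2) ≃ {i : Fin n // ¬ Even (i : ℕ)} where
  toFun i := ⟨⟨2 * i + 1, by omega⟩, by simp⟩
  invFun i := ⟨(i.1 : ℕ) / 2, by
    have := Nat.two_mul_div_two_add_one_of_odd (Nat.not_even_iff_odd.mp i.2)
    omega⟩
  left_inv i := by ext; simp only; omega
  right_inv i := by
    ext
    exact Nat.two_mul_div_two_add_one_of_odd (Nat.not_even_iff_odd.mp i.2)

theorem det_hankelMatrix_of_odd_eq_zero {R : Type*} [CommRing R] (n : ℕ) {m : ℕ → R}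
    (hm : ∀ k, Odd k → m k = 0) :
    (hankelMatrix n m).det = (hankelMatrix ((n + 1) / 2) fun k => m (2 * k)).det *
      (hankelMatrix (n / 2) fun k => m (2 * (k + 1))).det := by
  rw [Matrix.twoBlockTriangular_det _ fun i : Fin n => Even (i : ℕ)]
  · rw [← Matrix.det_submatrix_equiv_self (finEvenEquiv n),
      ← Matrix.det_submatrix_equiv_self (finOddEquiv n)]
    congr 2
    · ext i j
      exact congrArg m (mul_add 2 (i : ℕ) j).symm
    · ext i j
      exact congrArg m (by ring : 2 * (i : ℕ) + 1 + (2 * j + 1) = 2 * (i + j + 1))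
  · intro i hi j hj
    exact hm _ ((Nat.not_even_iff_odd.mp hi).add_even hj)

-- The last factor is monic of degree `j` in `i`, hence the Vandermonde determinant below.
theorem apply_add_of_recurrence {R : Type*} [CommSemiring R] {f : ℕ → R} {a b : R}
    (hf : ∀ k, f (k + 1) = (a + k) * b * f k) (i j : ℕ) :
    f (i + j) = f i * (b ^ j * (ascPochhammer R j).eval (a + i)) := by
  induction j with
  | zero => simp
  | succ j ih =>
    rw [← add_assoc, hf, ih, ascPochhammer_succ_eval, pow_succ]
    push_cast
    ring

theorem det_hankelMatrix_of_recurrence {R : Type*} [CommRing R] [IsDomain R] (n : ℕ) {f : ℕ → R}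
    {a b : R} (hf : ∀ k, f (k + 1) = (a + k) * b * f k) :
    (hankelMatrix n f).det = (∏ i : Fin n, f i) *
      ((∏ j : Fin n, b ^ (j : ℕ)) * (Matrix.vandermonde fun i : Fin n => ((i : ℕ) : R)).det) := by
  have det_ascPochhammer :
      (Matrix.of fun i j : Fin n => (ascPochhammer R (j : ℕ)).eval (a + (i : ℕ))).det =
        (Matrix.vandermonde fun i : Fin n => ((i : ℕ) : R)).det := by
    rw [← Matrix.det_eval_matrixOfPolynomials_eq_det_vandermonde (fun i : Fin n => a + (i : ℕ))
      (fun j => ascPochhammer R (j : ℕ)) (fun j => ascPochhammer_natDegree R _)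
      (fun j => monic_ascPochhammer R _)]
    simp only [Matrix.det_vandermonde, add_sub_add_left_eq_sub]
  rw [← det_ascPochhammer, ← Matrix.det_mul_row, ← Matrix.det_mul_column]
  congr 1
  ext i j
  exact apply_add_of_recurrence hf i j

theorem det_hankelMatrix_div_of_recurrence {K : Type*} [Field K] [CharZero K] (n : ℕ)
    {f g : ℕ → K} {a a' b : K} (hb : b ≠ 0) (hf : ∀ k, f (k + 1) = (a + k) * b * f k)
    (hg : ∀ k, g (k + 1) = (a' + k) * b * g k) :
    (hankelMatrix n f).det / (hankelMatrix n g).det = ∏ i ∈ Finset.range n, f i / g i := by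
  have vandermonde_ne_zero : (Matrix.vandermonde fun i : Fin n => ((i : ℕ) : K)).det ≠ 0 :=
    Matrix.det_vandermonde_ne_zero_iff.mpr (Nat.cast_injective.comp Fin.val_injective)
  have powers_ne_zero : ∏ j : Fin n, b ^ (j : ℕ) ≠ 0 :=
    Finset.prod_ne_zero_iff.mpr fun j _ => pow_ne_zero _ hb
  rw [det_hankelMatrix_of_recurrence n hf, det_hankelMatrix_of_recurrence n hg,
    mul_div_mul_right _ _ (mul_ne_zero powers_ne_zero vandermonde_ne_zero),
    ← Finset.prod_div_distrib, Fin.prod_univ_eq_prod_range fun i => f i / g i]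

end Hankel

/-! ### Moments of the Gaussian weight -/

section GaussianMoment

/-- The `k`-th moment `∫ x ^ k e^{-b x²} dx` of the Gaussian weight. -/
def gaussianMoment (b : ℝ) (k : ℕ) : ℝ := ∫ x : ℝ, x ^ k * Real.exp (-b * x ^ 2)

theorem gaussianMoment_of_odd (b : ℝ) {k : ℕ} (hk : Odd k) : gaussianMoment b k = 0 := by
  have reflection := integral_neg_eq_self (fun x : ℝ => x ^ k * Real.exp (-b * x ^ 2)) volume
  simp only [hk.neg_pow, neg_sq, neg_mul (_ ^ k), integral_neg] at reflection
  unfold gaussianMoment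
  linarith

variable {b : ℝ} (hb : 0 < b)
include hb

theorem integrable_pow_mul_exp_neg_mul_sq (k : ℕ) :
    Integrable fun x : ℝ => x ^ k * Real.exp (-b * x ^ 2) := by
  simpa only [Real.rpow_natCast] using
    integrable_rpow_mul_exp_neg_mul_sq hb (s := k) (by linarith [k.cast_nonneg (α := ℝ)])

theorem gaussianMoment_two_mul (k : ℕ) :
    gaussianMoment b (2 * k) = b ^ (-((k : ℝ) + 1 / 2)) * Real.Gamma (k + 1 / 2) := by
  have half_line := integral_rpow_mul_exp_neg_mul_rpow (p := 2) (q := ((2 * k : ℕ) : ℝ)) two_pos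
    (by linarith [(2 * k).cast_nonneg (α := ℝ)]) hb
  have even_integrand := integral_comp_abs (f := fun x : ℝ => x ^ (2 * k) * Real.exp (-b * x ^ 2))
  have exponent : (((2 * k : ℕ) : ℝ) + 1) / 2 = k + 1 / 2 := by push_cast; ring
  simp only [Real.rpow_natCast, Real.rpow_two, neg_div, exponent] at half_line
  simp only [sq_abs, (even_two_mul k).pow_abs, half_line] at even_integrand
  rw [gaussianMoment, even_integrand]
  ring

theorem gaussianMoment_two_mul_pos (k : ℕ) : 0 < gaussianMoment b (2 * k) := by
  rw [gaussianMoment_two_mul hb]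
  exact mul_pos (Real.rpow_pos_of_pos hb _) (Real.Gamma_pos_of_pos (by positivity))

theorem gaussianMoment_two_mul_succ (k : ℕ) :
    gaussianMoment b (2 * (k + 1)) = (1 / 2 + k) * b⁻¹ * gaussianMoment b (2 * k) := by
  have exponent : ((k + 1 : ℕ) : ℝ) + 1 / 2 = (k + 1 / 2) + 1 := by push_cast; ring
  rw [gaussianMoment_two_mul hb, gaussianMoment_two_mul hb, exponent,
    Real.Gamma_add_one (by positivity), neg_add, Real.rpow_add hb, Real.rpow_neg_one]
  ring

theorem gaussianMoment_two_mul_eq_factorial (k : ℕ) :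
    gaussianMoment b (2 * k) =
      (2 * k).factorial / ((4 * b) ^ k * k.factorial) * gaussianMoment b 0 := by
  induction k with
  | zero => simp
  | succ k ih =>
    rw [gaussianMoment_two_mul_succ hb, ih, mul_add_one, Nat.factorial_succ, Nat.factorial_succ,
      Nat.factorial_succ, pow_succ]
    push_cast
    field_simp
    ring

theorem det_hankelMatrix_gaussianMoment_div (n p : ℕ) :
    (hankelMatrix n fun k => gaussianMoment b (k + 2 * p)).det /
        (hankelMatrix n (gaussianMoment b)).det =
      (∏ i ∈ Finset.range ((n + 1) / 2),
          gaussianMoment b (2 * (i + p)) / gaussianMoment b (2 * i)) *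
        ∏ i ∈ Finset.range (n / 2),
          gaussianMoment b (2 * (i + 1 + p)) / gaussianMoment b (2 * (i + 1)) := by
  have recurrence (s k : ℕ) : gaussianMoment b (2 * (k + 1 + s)) =
      (1 / 2 + s + k) * b⁻¹ * gaussianMoment b (2 * (k + s)) := by
    rw [add_right_comm, gaussianMoment_two_mul_succ hb]
    push_cast
    ring
  have block_ratio (l s t : ℕ) :
      (hankelMatrix l fun k => gaussianMoment b (2 * (k + s))).det /
          (hankelMatrix l fun k => gaussianMoment b (2 * (k + t))).det =
        ∏ i ∈ Finset.range l, gaussianMoment b (2 * (i + s)) / gaussianMoment b (2 * (i + t)) :=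
    det_hankelMatrix_div_of_recurrence l (inv_ne_zero hb.ne') (recurrence s) (recurrence t)
  rw [det_hankelMatrix_of_odd_eq_zero n fun k hk => gaussianMoment_of_odd b hk,
    det_hankelMatrix_of_odd_eq_zero n fun k hk =>
      gaussianMoment_of_odd b (hk.add_even (even_two_mul p)), mul_div_mul_comm]
  simp only [← mul_add, add_assoc]
  exact congrArg₂ (· * ·) (block_ratio _ p 0) (block_ratio _ (1 + p) 1)

end GaussianMoment

/-! ### Determinantal moments of the Gaussian unitary ensemble -/

section GUE

theorem gueMatrix_det (N : ℕ) (ω : Matrix.unitaryGroup (Fin N) ℂ × (Fin N → ℝ)) :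
    (gueMatrix N ω).det = ((∏ j, ω.2 j : ℝ) : ℂ) := by
  have det_mul_det_star : (ω.1 : Matrix (Fin N) (Fin N) ℂ).det *
      (star (ω.1 : Matrix (Fin N) (Fin N) ℂ)).det = 1 := by
    rw [← Matrix.det_mul, Matrix.mem_unitaryGroup_iff.mp ω.1.2, Matrix.det_one]
  rw [gueMatrix, Matrix.det_mul, Matrix.det_mul, Matrix.det_diagonal, mul_right_comm,
    det_mul_det_star, one_mul, Complex.ofReal_prod]

theorem gueWeight_nonneg (N : ℕ) (x : Fin N → ℝ) : 0 ≤ gueWeight N x := by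
  unfold gueWeight
  positivity

theorem gueWeight_mul_prod_pow (N k : ℕ) (x : Fin N → ℝ) :
    gueWeight N x * (∏ j, x j) ^ k = (∏ j, ∏ i ∈ Finset.Ioi j, (x j - x i) ^ 2) *
      ∏ j, x j ^ k * Real.exp (-((N : ℝ) / 2) * x j ^ 2) := by
  simp only [gueWeight, Finset.prod_mul_distrib, Finset.prod_pow, mul_div_right_comm, neg_mul]
  ring

theorem integrable_pow_mul_pow_mul_exp {b : ℝ} (hb : 0 < b) (k i : ℕ) :
    Integrable fun x : ℝ => x ^ i * (x ^ k * Real.exp (-b * x ^ 2)) := by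
  simpa only [pow_add, mul_assoc] using integrable_pow_mul_exp_neg_mul_sq hb (i + k)

theorem integrable_gueWeight_mul_prod_pow {N : ℕ} (hN : 0 < N) (k : ℕ) :
    Integrable fun x : Fin N → ℝ => gueWeight N x * (∏ j, x j) ^ k := by
  simp only [gueWeight_mul_prod_pow]
  exact integrable_prod_sub_sq_mul_prod N (w := fun y => y ^ k * Real.exp (-((N : ℝ) / 2) * y ^ 2))
    (integrable_pow_mul_pow_mul_exp (by positivity) k)

theorem integral_gueWeight_mul_prod_pow {N : ℕ} (hN : 0 < N) (k : ℕ) :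
    ∫ x : Fin N → ℝ, gueWeight N x * (∏ j, x j) ^ k =
      N.factorial * (hankelMatrix N fun i => gaussianMoment (N / 2) (i + k)).det := by
  simp only [gueWeight_mul_prod_pow, gaussianMoment, pow_add, mul_assoc (_ ^ _)]
  exact integral_prod_sub_sq_mul_prod N (w := fun y => y ^ k * Real.exp (-((N : ℝ) / 2) * y ^ 2))
    (integrable_pow_mul_pow_mul_exp (by positivity) k)

theorem gueZ_eq_det {N : ℕ} (hN : 0 < N) :
    gueZ N = N.factorial * (hankelMatrix N (gaussianMoment (N / 2))).det := by
  simpa only [pow_zero, mul_one, add_zero, gueZ] using integral_gueWeight_mul_prod_pow hN 0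

theorem measurable_gueDensity (N : ℕ) :
    Measurable fun x : Fin N → ℝ => ENNReal.ofReal (gueWeight N x / gueZ N) := by
  unfold gueWeight
  fun_prop

theorem toReal_gueDensity_smul (N : ℕ) (x : Fin N → ℝ) (y : ℝ) :
    (ENNReal.ofReal (gueWeight N x / gueZ N)).toReal • y = (gueZ N)⁻¹ * (gueWeight N x * y) := by
  have gueZ_nonneg : 0 ≤ gueZ N := integral_nonneg (gueWeight_nonneg N)
  rw [ENNReal.toReal_ofReal (div_nonneg (gueWeight_nonneg N x) gueZ_nonneg), smul_eq_mul]
  ring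

instance unitaryHaar_isProbabilityMeasure (N : ℕ) : IsProbabilityMeasure (unitaryHaar N) :=
  ⟨Measure.haarMeasure_self⟩

instance gueEigenvalueLaw_sFinite (N : ℕ) : SFinite (gueEigenvalueLaw N) := by
  unfold gueEigenvalueLaw
  infer_instance

theorem integrable_gueMatrix_det_pow {N : ℕ} (hN : 0 < N) (k : ℕ) :
    Integrable (fun ω => (gueMatrix N ω).det ^ k) (gueProb N) := by
  have integrable_eigenvalues :
      Integrable (fun x : Fin N → ℝ => (∏ j, x j) ^ k) (gueEigenvalueLaw N) := by
    rw [gueEigenvalueLaw, integrable_withDensity_iff_integrable_smul' (measurable_gueDensity N)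
      (ae_of_all _ fun _ => ENNReal.ofReal_lt_top)]
    simp only [toReal_gueDensity_smul]
    exact (integrable_gueWeight_mul_prod_pow hN k).const_mul _
  simp only [gueMatrix_det, ← Complex.ofReal_pow]
  exact (integrable_eigenvalues.comp_snd (unitaryHaar N)).ofReal

theorem gueDetMoment_eq_integral (N k : ℕ) : gueDetMoment N k =
    (((gueZ N)⁻¹ * ∫ x : Fin N → ℝ, gueWeight N x * (∏ j, x j) ^ k : ℝ) : ℂ) := by
  unfold gueDetMoment gueProb
  simp only [gueMatrix_det, ← Complex.ofReal_pow]
  rw [integral_complex_ofReal,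
    integral_fun_snd (fun x : Fin N → ℝ => (∏ j, x j) ^ k), probReal_univ, one_smul,
    gueEigenvalueLaw, integral_withDensity_eq_integral_toReal_smul (measurable_gueDensity N)
      (ae_of_all _ fun _ => ENNReal.ofReal_lt_top)]
  simp only [toReal_gueDensity_smul, integral_const_mul]

theorem gueDetMoment_eq_det_div_det {N : ℕ} (hN : 0 < N) (k : ℕ) : gueDetMoment N k =
    (((hankelMatrix N fun i => gaussianMoment (N / 2) (i + k)).det /
      (hankelMatrix N (gaussianMoment (N / 2))).det : ℝ) : ℂ) := by
  rw [gueDetMoment_eq_integral, integral_gueWeight_mul_prod_pow hN, gueZ_eq_det hN,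
    inv_mul_eq_div, mul_div_mul_left _ _ (Nat.cast_ne_zero.mpr N.factorial_ne_zero)]

end GUE

/-! ### The closed form of the moments -/

section ClosedForm

theorem prod_range_two_mul_eq_prod_pairs {M : Type*} [CommMonoid M] (f : ℕ → M) (n : ℕ) :
    ∏ i ∈ Finset.range (2 * n), f i = ∏ j ∈ Finset.range n, f (2 * j) * f (2 * j + 1) := by
  induction n with
  | zero => rfl
  | succ n ih =>
    rw [mul_add_one, Finset.prod_range_succ, Finset.prod_range_succ, Finset.prod_range_succ, ih,
      mul_assoc]

theorem prod_range_shift_div_comm {G : Type*} [CommGroupWithZero G] {f : ℕ → G}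
    (hf : ∀ i, f i ≠ 0) (n p : ℕ) :
    ∏ i ∈ Finset.range n, f (i + p) / f i = ∏ j ∈ Finset.range p, f (n + j) / f j := by
  have prod_ne_zero (k : ℕ) : ∏ i ∈ Finset.range k, f i ≠ 0 :=
    Finset.prod_ne_zero_iff.mpr fun i _ => hf i
  rw [Finset.prod_div_distrib, Finset.prod_div_distrib,
    div_eq_div_iff (prod_ne_zero n) (prod_ne_zero p)]
  calc (∏ i ∈ Finset.range n, f (i + p)) * ∏ j ∈ Finset.range p, f j
      = ∏ i ∈ Finset.range (p + n), f i := by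
        rw [Finset.prod_range_add, mul_comm]
        simp only [add_comm p]
    _ = (∏ j ∈ Finset.range p, f (n + j)) * ∏ i ∈ Finset.range n, f i := by
        rw [add_comm, Finset.prod_range_add, mul_comm]

/-- The contribution of the index `j < p` to `(2N)^{Np} 𝔼[det M^{2p}]`, a product of `p` such
factors; with natural number division it covers both parities of `N`. -/
def momentFactor (N j : ℕ) : ℝ :=
  ((N + 2 * j).factorial * (N + 2 * j + 1).factorial : ℝ) /
      ((2 * j).factorial * (2 * j + 1).factorial) *
    ((j.factorial : ℝ) ^ 2 / ((N / 2 + j).factorial * ((N + 1) / 2 + j).factorial))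

theorem factorial_two_mul_succ_div_factorial_succ (k : ℕ) :
    ((2 * (k + 1)).factorial : ℝ) / (k + 1).factorial =
      2 * ((2 * k + 1).factorial / k.factorial) := by
  rw [mul_add_one, Nat.factorial_succ (2 * k + 1), Nat.factorial_succ k]
  push_cast
  field_simp
  ring

theorem gaussianMoment_div_mul_gaussianMoment_div {b : ℝ} (hb : 0 < b) (m n j : ℕ) :
    gaussianMoment b (2 * (n + j)) / gaussianMoment b (2 * j) *
        (gaussianMoment b (2 * (m + j + 1)) / gaussianMoment b (2 * (j + 1))) =
      ((2 * (n + j)).factorial * (2 * (m + j) + 1).factorial : ℝ) /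
          ((2 * j).factorial * (2 * j + 1).factorial) *
        ((j.factorial : ℝ) ^ 2 / ((m + j).factorial * (n + j).factorial)) / (4 * b) ^ (m + n) := by
  have normalized (k : ℕ) : gaussianMoment b (2 * k) =
      (2 * k).factorial / k.factorial / (4 * b) ^ k * gaussianMoment b 0 := by
    rw [gaussianMoment_two_mul_eq_factorial hb, div_div, mul_comm (_ ^ _)]
  have moment_zero_ne_zero : gaussianMoment b 0 ≠ 0 := (gaussianMoment_two_mul_pos hb 0).ne'
  rw [normalized, normalized j, normalized (m + j + 1), normalized (j + 1),
    factorial_two_mul_succ_div_factorial_succ, factorial_two_mul_succ_div_factorial_succ]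
  field_simp
  ring

theorem gaussianMoment_div_mul_gaussianMoment_div_eq_momentFactor {N : ℕ} (hN : 0 < N) (j : ℕ) :
    gaussianMoment (N / 2) (2 * ((N + 1) / 2 + j)) / gaussianMoment (N / 2) (2 * j) *
        (gaussianMoment (N / 2) (2 * (N / 2 + j + 1)) / gaussianMoment (N / 2) (2 * (j + 1))) =
      momentFactor N j / (2 * N) ^ N := by
  have numerator : ((2 * ((N + 1) / 2 + j)).factorial * (2 * (N / 2 + j) + 1).factorial : ℝ) =
      (N + 2 * j).factorial * (N + 2 * j + 1).factorial := by
    rcases N.even_or_odd' with ⟨m, rfl | rfl⟩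
    · rw [show (2 * m + 1) / 2 = m by omega, Nat.mul_div_cancel_left m two_pos, mul_add]
    · rw [show (2 * m + 1 + 1) / 2 = m + 1 by omega, show (2 * m + 1) / 2 = m by omega, mul_comm]
      ring_nf
  rw [gaussianMoment_div_mul_gaussianMoment_div (by positivity), numerator, momentFactor,
    show N / 2 + (N + 1) / 2 = N by omega, show (4 : ℝ) * (N / 2) = 2 * N by ring]

theorem gueDetMoment_eq_prod_momentFactor {N : ℕ} (hN : 0 < N) (p : ℕ) :
    gueDetMoment N (2 * p) =
      (((∏ j ∈ Finset.range p, momentFactor N j) / (2 * N) ^ (N * p) : ℝ) : ℂ) := by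
  have hb : (0 : ℝ) < N / 2 := by positivity
  have moment_ne_zero (k : ℕ) : gaussianMoment (N / 2) (2 * k) ≠ 0 :=
    (gaussianMoment_two_mul_pos hb k).ne'
  rw [gueDetMoment_eq_det_div_det hN, det_hankelMatrix_gaussianMoment_div hb,
    prod_range_shift_div_comm moment_ne_zero]
  simp only [add_right_comm _ 1 p]
  rw [prod_range_shift_div_comm (f := fun k => gaussianMoment (N / 2) (2 * (k + 1)))
      fun k => moment_ne_zero (k + 1), ← Finset.prod_mul_distrib]
  simp only [gaussianMoment_div_mul_gaussianMoment_div_eq_momentFactor hN, Finset.prod_div_distrib,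
    Finset.prod_const, Finset.card_range, pow_mul]

theorem Cpart_rectPart_self (N n : ℕ) : Cpart (rectPart N n) n =
    ∏ i ∈ Finset.range n, ((N + i).factorial : ℝ) / i.factorial := by
  unfold Cpart
  refine Finset.prod_bij' (fun j _ => n - j) (fun i _ => n - i) ?_ ?_ ?_ ?_ ?_ <;>
    simp only [Finset.mem_Icc, Finset.mem_range]
  · omega
  · omega
  · omega
  · omega
  · intro j hj
    rw [rectPart, if_pos hj, Nat.add_sub_assoc hj.2]

theorem Cpart_rectPart_two_mul (N p : ℕ) : Cpart (rectPart N (2 * p)) (2 * p) =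
    ∏ j ∈ Finset.range p, ((N + 2 * j).factorial * (N + 2 * j + 1).factorial : ℝ) /
      ((2 * j).factorial * (2 * j + 1).factorial) := by
  simp only [Cpart_rectPart_self, prod_range_two_mul_eq_prod_pairs, div_mul_div_comm, ← add_assoc]

theorem Cpart_mul_De {N : ℕ} (hN : Even N) (p : ℕ) :
    Cpart (rectPart N (2 * p)) (2 * p) * De p N = ∏ j ∈ Finset.range p, momentFactor N j := by
  have half_succ : (N + 1) / 2 = N / 2 := by rcases hN with ⟨m, rfl⟩; omega
  rw [Cpart_rectPart_two_mul, De, ← Finset.prod_mul_distrib]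
  simp only [momentFactor, half_succ, sq ((N / 2 + _).factorial : ℝ)]

theorem Do_eq_prod (p N : ℕ) : Do p N = (-1) ^ p * ∏ j ∈ Finset.range p,
    (j.factorial : ℝ) ^ 2 / ((N / 2 + j).factorial * (N / 2 + 1 + j).factorial) := by
  have telescope : ((N / 2).factorial : ℝ) / (N / 2 + p).factorial =
      ∏ j ∈ Finset.range p, ((N / 2 + j).factorial : ℝ) / (N / 2 + 1 + j).factorial := by
    induction p with
    | zero => simp [Nat.factorial_ne_zero]
    | succ p ih =>
      rw [Finset.prod_range_succ, ← ih, add_right_comm, add_assoc,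
        div_mul_div_cancel₀ (Nat.cast_ne_zero.mpr (Nat.factorial_ne_zero _))]
  rw [Do, telescope, mul_assoc, ← Finset.prod_mul_distrib]
  congr 1
  refine Finset.prod_congr rfl fun j _ => ?_
  field_simp

theorem Cpart_mul_Do {N : ℕ} (hN : Odd N) (p : ℕ) :
    Cpart (rectPart N (2 * p)) (2 * p) * Do p N =
      (-1) ^ p * ∏ j ∈ Finset.range p, momentFactor N j := by
  have half_succ : (N + 1) / 2 = N / 2 + 1 := by rcases hN with ⟨m, rfl⟩; omega
  rw [Cpart_rectPart_two_mul, Do_eq_prod, mul_left_comm, ← Finset.prod_mul_distrib]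
  simp only [momentFactor, half_succ]

theorem gueDetMoment_of_even {N : ℕ} (hN : 0 < N) (hN_even : Even N) (p : ℕ) :
    gueDetMoment N (2 * p) = (((-(1 / (2 * (N : ℝ)))) ^ (N * p) *
      (Cpart (rectPart N (2 * p)) (2 * p) * De p N) : ℝ) : ℂ) := by
  rw [gueDetMoment_eq_prod_momentFactor hN, Cpart_mul_De hN_even, (hN_even.mul_right p).neg_pow,
    one_div, inv_pow, inv_mul_eq_div]

theorem gueDetMoment_of_odd {N : ℕ} (hN : 0 < N) (hN_odd : Odd N) (p : ℕ) :
    gueDetMoment N (2 * p) = (((-(1 / (2 * (N : ℝ)))) ^ (N * p) *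
      (Cpart (rectPart N (2 * p)) (2 * p) * Do p N) : ℝ) : ℂ) := by
  have sign_mul_sign : (-1 : ℝ) ^ (N * p) * (-1) ^ p = 1 := by
    rw [← pow_add, ← add_one_mul, (hN_odd.add_one.mul_right p).neg_one_pow]
  rw [gueDetMoment_eq_prod_momentFactor hN, Cpart_mul_Do hN_odd, neg_pow, one_div, inv_pow,
    mul_mul_mul_comm, sign_mul_sign, one_mul, inv_mul_eq_div]

end ClosedForm

/-! ### First order asymptotic expansions -/

/-- The expansion `f = 1 + c ε + O(ε²)` along `l`, where the scale `ε` is meant to tend to `0`. -/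
def HasUnitExpansion {α : Type*} (l : Filter α) (ε f : α → ℝ) (c : ℝ) : Prop :=
  (fun x => f x - (1 + c * ε x)) =O[l] fun x => ε x ^ 2

namespace HasUnitExpansion

variable {α : Type*} {l : Filter α} {ε f g : α → ℝ} {c d : ℝ}

theorem congr' (hf : HasUnitExpansion l ε f c) (hfg : f =ᶠ[l] g) : HasUnitExpansion l ε g c :=
  IsBigO.congr' hf (hfg.mono fun x hx => by simp only [hx]) EventuallyEq.rfl

theorem mono {l' : Filter α} (hf : HasUnitExpansion l ε f c) (hl : l' ≤ l) :
    HasUnitExpansion l' ε f c :=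
  IsBigO.mono hf hl

theorem comp_tendsto {β : Type*} {l' : Filter β} {k : β → α} (hf : HasUnitExpansion l ε f c)
    (hk : Tendsto k l' l) : HasUnitExpansion l' (ε ∘ k) (f ∘ k) c :=
  IsBigO.comp_tendsto hf hk

theorem one_add_mul (l : Filter α) (ε : α → ℝ) (c : ℝ) :
    HasUnitExpansion l ε (fun x => 1 + c * ε x) c := by
  simpa only [HasUnitExpansion, sub_self] using isBigO_zero _ _

theorem const_mul_isBigO {h : α → ℝ} (hε : Tendsto ε l (𝓝 0))
    (hh : (fun x => h x - c * ε x) =O[l] fun x => ε x ^ 2) : h =O[l] ε := by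
  have sq_isBigO : (fun x => ε x ^ 2) =O[l] ε := by
    simpa only [sq, one_mul] using (hε.isBigO_one ℝ).mul (isBigO_refl ε l)
  exact ((hh.trans sq_isBigO).add ((isBigO_refl ε l).const_mul_left c)).congr_left fun x => by ring

theorem sub_one_isBigO (hf : HasUnitExpansion l ε f c) (hε : Tendsto ε l (𝓝 0)) :
    (fun x => f x - 1) =O[l] ε :=
  const_mul_isBigO hε (hf.congr_left fun x => by ring)

theorem tendsto_one (hf : HasUnitExpansion l ε f c) (hε : Tendsto ε l (𝓝 0)) :
    Tendsto f l (𝓝 1) :=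
  tendsto_sub_nhds_zero_iff.mp ((hf.sub_one_isBigO hε).trans_tendsto hε)

theorem mul (hf : HasUnitExpansion l ε f c) (hg : HasUnitExpansion l ε g d)
    (hε : Tendsto ε l (𝓝 0)) : HasUnitExpansion l ε (fun x => f x * g x) (c + d) := by
  have cross_term : (fun x => (f x - 1) * (g x - 1)) =O[l] fun x => ε x ^ 2 := by
    simpa only [sq] using (hf.sub_one_isBigO hε).mul (hg.sub_one_isBigO hε)
  exact ((cross_term.add hf).add hg).congr_left fun x => by ring

theorem prod {ι : Type*} {s : Finset ι} {f : ι → α → ℝ} {c : ι → ℝ}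
    (hf : ∀ i ∈ s, HasUnitExpansion l ε (f i) (c i)) (hε : Tendsto ε l (𝓝 0)) :
    HasUnitExpansion l ε (fun x => ∏ i ∈ s, f i x) (∑ i ∈ s, c i) := by
  classical
  induction s using Finset.induction_on with
  | empty => simpa using one_add_mul l ε 0
  | insert i s hi ih =>
    simp only [Finset.prod_insert hi, Finset.sum_insert hi]
    exact (hf i (Finset.mem_insert_self i s)).mul
      (ih fun j hj => hf j (Finset.mem_insert_of_mem hj)) hε

theorem rescale {δ : α → ℝ} (hf : HasUnitExpansion l δ f c)
    (hδ : (fun x => δ x - d * ε x) =O[l] fun x => ε x ^ 2) (hε : Tendsto ε l (𝓝 0)) :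
    HasUnitExpansion l ε f (c * d) :=
  ((hf.trans ((const_mul_isBigO hε hδ).pow 2)).add (hδ.const_mul_left c)).congr_left
    fun x => by ring

theorem of_analyticAt {φ : ℝ → ℝ} {a b : ℝ} (hφ : AnalyticAt ℝ φ a) (hφ_one : φ a = 1)
    (hφ_deriv : HasDerivAt φ b a) : HasUnitExpansion (𝓝 a) (fun y => y - a) φ b := by
  obtain ⟨series, h_series⟩ := hφ
  have tendsto_sub : Tendsto (fun y => y - a) (𝓝 a) (𝓝 0) :=
    tendsto_sub_nhds_zero_iff.mpr tendsto_id
  have coeff_zero : series.coeff 0 = 1 := (h_series.coeff_zero _).trans hφ_one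
  have coeff_one : series.coeff 1 = b := h_series.hasDerivAt.unique hφ_deriv
  have remainder := (h_series.isBigO_sub_partialSum_pow 2).comp_tendsto tendsto_sub
  refine (remainder.congr_left fun y => ?_).trans
    (isBigO_of_le _ fun y => by simp)
  simp only [Function.comp_apply, add_sub_cancel, FormalMultilinearSeries.partialSum,
    FormalMultilinearSeries.apply_eq_prod_smul_coeff, Finset.sum_range_succ, Finset.sum_range_zero,
    Fin.prod_const, smul_eq_mul, coeff_zero, coeff_one]
  ring

theorem analyticAt_comp {φ : ℝ → ℝ} {a b : ℝ} {h : α → ℝ} (hφ : AnalyticAt ℝ φ a)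
    (hφ_one : φ a = 1) (hφ_deriv : HasDerivAt φ b a)
    (hh : (fun x => h x - a - c * ε x) =O[l] fun x => ε x ^ 2) (hε : Tendsto ε l (𝓝 0)) :
    HasUnitExpansion l ε (fun x => φ (h x)) (b * c) := by
  have tendsto_h : Tendsto h l (𝓝 a) :=
    tendsto_sub_nhds_zero_iff.mp ((const_mul_isBigO hε hh).trans_tendsto hε)
  exact ((of_analyticAt hφ hφ_one hφ_deriv).comp_tendsto tendsto_h).rescale hh hε

theorem inv (hf : HasUnitExpansion l ε f c) (hε : Tendsto ε l (𝓝 0)) :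
    HasUnitExpansion l ε (fun x => (f x)⁻¹) (-c) := by
  simpa using analyticAt_comp (analyticAt_inv one_ne_zero) inv_one (hasDerivAt_inv one_ne_zero)
    (hf.congr_left fun x => by ring) hε

theorem div (hf : HasUnitExpansion l ε f c) (hg : HasUnitExpansion l ε g d)
    (hε : Tendsto ε l (𝓝 0)) : HasUnitExpansion l ε (fun x => f x / g x) (c - d) := by
  simpa only [div_eq_mul_inv, sub_eq_add_neg] using hf.mul (hg.inv hε) hε

theorem sqrt (hf : HasUnitExpansion l ε f c) (hε : Tendsto ε l (𝓝 0)) :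
    HasUnitExpansion l ε (fun x => √(f x)) (c / 2) := by
  have sqrt_deriv : HasDerivAt Real.sqrt (1 / 2) 1 := by
    simpa using Real.hasDerivAt_sqrt one_ne_zero
  simpa [div_eq_inv_mul] using analyticAt_comp
    (Real.contDiffAt_sqrt one_ne_zero).analyticAt Real.sqrt_one sqrt_deriv
    (hf.congr_left fun x => by ring) hε

theorem exp {h : α → ℝ} (hh : (fun x => h x - c * ε x) =O[l] fun x => ε x ^ 2)
    (hε : Tendsto ε l (𝓝 0)) : HasUnitExpansion l ε (fun x => Real.exp (h x)) c := by
  have exp_deriv : HasDerivAt Real.exp 1 0 := by simpa using Real.hasDerivAt_exp 0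
  simpa using analyticAt_comp analyticAt_rexp Real.exp_zero exp_deriv
    (by simpa only [sub_zero] using hh) hε

end HasUnitExpansion

/-! ### Stirling's series and central binomial coefficients -/

section Stirling

theorem tendsto_log_stirlingSeq_succ_sub {r : ℕ → ℝ} (hr : Tendsto r atTop (𝓝 0)) :
    Tendsto (fun n => Real.log (Stirling.stirlingSeq (n + 1)) - r n) atTop
      (𝓝 (Real.log √Real.pi)) := by
  have tendsto_log := (Real.continuousAt_log (Real.sqrt_ne_zero'.mpr Real.pi_pos)).tendsto.comp
    ((tendsto_add_atTop_iff_nat 1).mpr Stirling.tendsto_stirlingSeq_sqrt_pi)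
  simpa using tendsto_log.sub hr

theorem tendsto_one_div_mul_succ_add (a : ℝ) :
    Tendsto (fun n : ℕ => 1 / (12 * ((n : ℝ) + 1) + a)) atTop (𝓝 0) := by
  simp only [one_div]
  exact tendsto_inv_atTop_zero.comp <| tendsto_atTop_add_const_right _ _ <|
    (tendsto_atTop_add_const_right _ _ tendsto_natCast_atTop_atTop).const_mul_atTop (by norm_num)

-- The decrements of `log (stirlingSeq n)` lie between those of `1 / (12 n + 1)` and `1 / (12 n)`,
-- and all three sequences converge, so these bounds survive the passage to the limit.
theorem log_stirlingSeq_succ_le (n : ℕ) :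
    Real.log (Stirling.stirlingSeq (n + 1)) - Real.log √Real.pi ≤ 1 / (12 * ((n : ℝ) + 1)) := by
  have monotone_sub : Monotone fun n : ℕ =>
      Real.log (Stirling.stirlingSeq (n + 1)) - 1 / (12 * ((n : ℝ) + 1) + 0) := by
    refine monotone_nat_of_le_succ fun n => ?_
    have telescoping : 1 / (12 * ((n : ℝ) + 1)) - 1 / (12 * ((n : ℝ) + 1 + 1)) =
        1 / (12 * ((n : ℝ) + 1) * ((n : ℝ) + 1 + 1)) := by
      field
    have step := Stirling.log_stirlingSeq_sdiff_le (n + 1)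
    simp only [add_zero]
    push_cast at step ⊢
    linarith
  have le_limit := monotone_sub.ge_of_tendsto
    (tendsto_log_stirlingSeq_succ_sub (tendsto_one_div_mul_succ_add 0)) n
  simp only [add_zero] at le_limit
  linarith

theorem le_log_stirlingSeq_succ (n : ℕ) :
    1 / (12 * ((n : ℝ) + 1) + 1) ≤
      Real.log (Stirling.stirlingSeq (n + 1)) - Real.log √Real.pi := by
  have antitone_sub : Antitone fun n : ℕ =>
      Real.log (Stirling.stirlingSeq (n + 1)) - 1 / (12 * ((n : ℝ) + 1) + 1) := by
    refine antitone_nat_of_succ_le fun n => ?_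
    have first_term := le_hasSum (Stirling.log_stirlingSeq_sdiff_hasSum n) 0
      fun k _ => by positivity
    have telescoping : 1 / (12 * ((n : ℝ) + 1) + 1) - 1 / (12 * ((n : ℝ) + 1 + 1) + 1) ≤
        1 / (2 * (0 + 1) + 1) * ((1 / (2 * ((n : ℝ) + 1) + 1)) ^ 2) ^ (0 + 1) := by
      rw [div_sub_div _ _ (by positivity) (by positivity), zero_add, pow_one, one_div_pow,
        one_div_mul_one_div, div_le_div_iff₀ (by positivity) (by positivity)]
      nlinarith [n.cast_nonneg (α := ℝ)]
    push_cast at first_term ⊢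
    linarith
  have limit_le := antitone_sub.le_of_tendsto
    (tendsto_log_stirlingSeq_succ_sub (tendsto_one_div_mul_succ_add 1)) n
  linarith

theorem hasUnitExpansion_stirlingSeq : HasUnitExpansion atTop (fun n : ℕ => (n : ℝ)⁻¹)
    (fun n => Stirling.stirlingSeq n / √Real.pi) (1 / 12) := by
  have log_expansion : (fun n : ℕ => Real.log (Stirling.stirlingSeq n) - Real.log √Real.pi -
      1 / 12 * (n : ℝ)⁻¹) =O[atTop] fun n : ℕ => (n : ℝ)⁻¹ ^ 2 := by
    refine IsBigO.of_bound 1 ?_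
    filter_upwards [eventually_ne_atTop 0] with n hn
    obtain ⟨k, rfl⟩ := Nat.exists_eq_succ_of_ne_zero hn
    have upper := log_stirlingSeq_succ_le k
    have lower := le_log_stirlingSeq_succ k
    have gap : 1 / (12 * ((k : ℝ) + 1)) - 1 / (12 * ((k : ℝ) + 1) + 1) ≤ ((k : ℝ) + 1)⁻¹ ^ 2 := by
      rw [div_sub_div _ _ (by positivity) (by positivity), inv_pow, inv_eq_one_div,
        div_le_div_iff₀ (by positivity) (by positivity)]
      nlinarith [k.cast_nonneg (α := ℝ)]
    have coefficient : 1 / 12 * ((k : ℝ) + 1)⁻¹ = 1 / (12 * (k + 1)) := by field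
    rw [Nat.succ_eq_add_one, Nat.cast_add_one, coefficient, Real.norm_eq_abs, Real.norm_eq_abs,
      abs_sq, one_mul, abs_le]
    constructor <;> linarith [sq_nonneg ((k : ℝ) + 1)⁻¹]
  refine (HasUnitExpansion.exp log_expansion tendsto_inv_atTop_nhds_zero_nat).congr' ?_
  filter_upwards [eventually_ne_atTop 0] with n hn
  obtain ⟨k, rfl⟩ := Nat.exists_eq_succ_of_ne_zero hn
  rw [Real.exp_sub, Real.exp_log (Stirling.stirlingSeq'_pos k),
    Real.exp_log (Real.sqrt_pos.mpr Real.pi_pos)]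

theorem factorial_eq_stirlingSeq_mul {n : ℕ} (hn : n ≠ 0) :
    (n.factorial : ℝ) = Stirling.stirlingSeq n * (√(2 * n) * (n / Real.exp 1) ^ n) := by
  rw [Stirling.stirlingSeq, div_mul_cancel₀]
  positivity

theorem centralBinom_mul_sqrt_div_eq {n : ℕ} (hn : n ≠ 0) :
    (n.centralBinom : ℝ) * √(Real.pi * n) / 4 ^ n =
      Stirling.stirlingSeq (2 * n) / √Real.pi / (Stirling.stirlingSeq n / √Real.pi *
        (Stirling.stirlingSeq n / √Real.pi)) := by
  have sqrt_four_mul : √(2 * ((2 * n : ℕ) : ℝ)) = 2 * √n := by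
    rw [show (2 * ((2 * n : ℕ) : ℝ)) = 2 ^ 2 * n by push_cast; ring,
      Real.sqrt_mul (by positivity), Real.sqrt_sq two_pos.le]
  have choose_eq : (n.centralBinom : ℝ) = (2 * n).factorial / (n.factorial * n.factorial) := by
    rw [Nat.centralBinom_eq_two_mul_choose, Nat.cast_choose ℝ (by omega), two_mul,
      Nat.add_sub_cancel]
  have pow_eq : (((2 * n : ℕ) : ℝ) / Real.exp 1) ^ (2 * n) =
      4 ^ n * ((n / Real.exp 1) ^ n) ^ 2 := by
    rw [Nat.cast_mul, Nat.cast_two, mul_div_assoc, mul_pow, pow_mul, pow_mul',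
      show (2 : ℝ) ^ 2 = 4 by norm_num]
  have sqrt_sq_eq : √(2 * (n : ℝ)) ^ 2 = 2 * √n ^ 2 := by
    rw [Real.sq_sqrt (by positivity), Real.sq_sqrt (by positivity)]
  have : 0 < √(n : ℝ) := by positivity
  have : 0 < √(2 * (n : ℝ)) := by positivity
  rw [choose_eq, Stirling.stirlingSeq, Stirling.stirlingSeq, sqrt_four_mul, pow_eq,
    Real.sqrt_mul Real.pi_pos.le]
  field_simp
  rw [sqrt_sq_eq, mul_comm]

theorem hasUnitExpansion_centralBinom : HasUnitExpansion atTop (fun n : ℕ => (n : ℝ)⁻¹)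
    (fun n => (n.centralBinom : ℝ) * √(Real.pi * n) / 4 ^ n) (-(1 / 8)) := by
  have double : HasUnitExpansion atTop (fun n : ℕ => (n : ℝ)⁻¹)
      (fun n => Stirling.stirlingSeq (2 * n) / √Real.pi) (1 / 12 * (1 / 2)) := by
    refine (hasUnitExpansion_stirlingSeq.comp_tendsto
      (tendsto_id.const_mul_atTop' two_pos)).rescale ?_ tendsto_inv_atTop_nhds_zero_nat
    refine (isBigO_zero _ _).congr_left fun n => ?_
    simp [mul_comm]
  have quotient := double.div (hasUnitExpansion_stirlingSeq.mul hasUnitExpansion_stirlingSeq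
    tendsto_inv_atTop_nhds_zero_nat) tendsto_inv_atTop_nhds_zero_nat
  rw [show (1 / 12 * (1 / 2) - (1 / 12 + 1 / 12) : ℝ) = -(1 / 8) by norm_num] at quotient
  refine quotient.congr' ?_
  filter_upwards [eventually_ne_atTop 0] with n hn
  exact (centralBinom_mul_sqrt_div_eq hn).symm

end Stirling

/-! ### Asymptotics of the moments -/

section Asymptotics

theorem eventually_even : ∀ᶠ N in evenTop, Even N :=
  (inf_le_right : evenTop ≤ _) (mem_principal_self _)

theorem eventually_odd : ∀ᶠ N in oddTop, Odd N :=
  (inf_le_right : oddTop ≤ _) (mem_principal_self _)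

theorem evenTop_le_atTop : evenTop ≤ atTop := inf_le_left

theorem oddTop_le_atTop : oddTop ≤ atTop := inf_le_left

theorem evenTop_sup_oddTop : evenTop ⊔ oddTop = atTop := by
  have parity_cover : {N : ℕ | Even N} ∪ {N : ℕ | Odd N} = Set.univ :=
    Set.eq_univ_of_forall Nat.even_or_odd
  rw [evenTop, oddTop, ← inf_sup_left, sup_principal, parity_cover, principal_univ, inf_top_eq]

theorem tendsto_inv_evenTop : Tendsto (fun N : ℕ => (N : ℝ)⁻¹) evenTop (𝓝 0) :=
  tendsto_inv_atTop_nhds_zero_nat.mono_left evenTop_le_atTop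

theorem tendsto_inv_oddTop : Tendsto (fun N : ℕ => (N : ℝ)⁻¹) oddTop (𝓝 0) :=
  tendsto_inv_atTop_nhds_zero_nat.mono_left oddTop_le_atTop

/-- The leading order of `momentFactor N j` as `N → ∞`. -/
def leadingFactor (N j : ℕ) : ℝ :=
  Real.exp (-N) * (2 * N) ^ (N + (2 * j + 1)) *
    ((j.factorial : ℝ) ^ 2 / ((2 * j).factorial * (2 * j + 1).factorial))

theorem gammaConst_eq_prod (p : ℕ) :
    gammaConst p = ∏ j ∈ Finset.range p,
      (j.factorial : ℝ) ^ 2 / ((2 * j).factorial * (2 * j + 1).factorial) := by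
  have prod_ne_zero : ∏ j ∈ Finset.range p, (j.factorial : ℝ) ≠ 0 :=
    Finset.prod_ne_zero_iff.mpr fun j _ => by positivity
  rw [gammaConst, Finset.prod_div_distrib, Finset.prod_div_distrib, Finset.prod_pow,
    ← prod_range_two_mul_eq_prod_pairs (fun i => (i.factorial : ℝ)), two_mul,
    Finset.prod_range_add, sq, mul_div_mul_left _ _ prod_ne_zero]

theorem prod_leadingFactor (N p : ℕ) :
    ∏ j ∈ Finset.range p, leadingFactor N j =
      Real.exp (-((N : ℝ) * p)) * (2 * (N : ℝ)) ^ (N * p + p ^ 2) * gammaConst p := by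
  have sum_exponents : ∑ j ∈ Finset.range p, (N + (2 * j + 1)) = N * p + p ^ 2 := by
    induction p with
    | zero => rfl
    | succ p ih => rw [Finset.sum_range_succ, ih]; ring
  simp only [leadingFactor, Finset.prod_mul_distrib, Finset.prod_const, Finset.card_range,
    Finset.prod_pow_eq_pow_sum, sum_exponents]
  rw [← gammaConst_eq_prod, ← Real.exp_nat_mul, mul_neg, mul_comm (p : ℝ)]

theorem factorial_mul_succ_div_leadingFactor_zero {N : ℕ} (hN : N ≠ 0) :
    (N.factorial * (N + 1) : ℝ) / leadingFactor N 0 =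
      Stirling.stirlingSeq N * (1 + (N : ℝ)⁻¹) * (√(2 * N) / 2 ^ (N + 1)) := by
  have exp_eq : Real.exp (-N) = 1 / Real.exp 1 ^ N := by
    rw [Real.exp_neg, one_div, ← Real.exp_nat_mul, mul_one]
  have leading_eq : leadingFactor N 0 = 2 ^ (N + 1) * N * (N / Real.exp 1) ^ N := by
    rw [leadingFactor, exp_eq, div_pow, mul_pow]
    simp only [mul_zero, zero_add, Nat.factorial_zero, Nat.factorial_one, Nat.cast_one, one_pow,
      mul_one, div_one]
    ring
  rw [factorial_eq_stirlingSeq_mul hN, leading_eq]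
  field_simp

theorem momentFactor_zero_of_even {N : ℕ} (hN : Even N) :
    momentFactor N 0 = N.factorial * (N + 1) * (N / 2).centralBinom := by
  obtain ⟨m, rfl⟩ := hN.two_dvd
  rw [Nat.mul_div_cancel_left m two_pos, Nat.centralBinom_eq_two_mul_choose,
    Nat.cast_choose ℝ (by omega), momentFactor, Nat.mul_div_cancel_left m two_pos,
    show (2 * m + 1) / 2 = m by omega, show 2 * m - m = m by omega]
  simp only [mul_zero, add_zero, zero_add, Nat.factorial_succ, Nat.factorial_zero, Nat.cast_mul,
    Nat.cast_add, Nat.cast_ofNat, Nat.cast_one, mul_one, one_pow, div_one]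
  ring

theorem momentFactor_zero_of_odd {N : ℕ} (hN : Odd N) :
    momentFactor N 0 = N.factorial * (N + 1) * (((N + 1) / 2).centralBinom / 2) := by
  obtain ⟨m, rfl⟩ := hN
  rw [show (2 * m + 1 + 1) / 2 = m + 1 by omega, Nat.centralBinom_eq_two_mul_choose,
    Nat.cast_choose ℝ (by omega), momentFactor, show (2 * m + 1 + 1) / 2 = m + 1 by omega,
    show (2 * m + 1) / 2 = m by omega, show 2 * (m + 1) - (m + 1) = m + 1 by omega,
    show 2 * (m + 1) = 2 * m + 1 + 1 by omega]
  simp only [mul_zero, add_zero, zero_add, Nat.factorial_succ, Nat.factorial_zero, Nat.cast_mul,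
    Nat.cast_add, Nat.cast_ofNat, Nat.cast_one, mul_one, one_pow, div_one]
  field_simp
  ring

theorem hasUnitExpansion_centralBinom_half :
    HasUnitExpansion evenTop (fun N : ℕ => (N : ℝ)⁻¹)
      (fun N => ((N / 2).centralBinom : ℝ) * √(Real.pi * (N / 2 : ℕ)) / 4 ^ (N / 2))
      (-(1 / 4)) := by
  have tendsto_half : Tendsto (fun N : ℕ => N / 2) evenTop atTop :=
    (Nat.tendsto_div_const_atTop two_ne_zero).mono_left evenTop_le_atTop
  rw [show -(1 / 4 : ℝ) = -(1 / 8) * 2 by norm_num]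
  refine (hasUnitExpansion_centralBinom.comp_tendsto tendsto_half).rescale ?_ tendsto_inv_evenTop
  refine (isBigO_zero _ _).congr' ?_ EventuallyEq.rfl
  filter_upwards [eventually_even] with N hN
  rw [Function.comp_apply, Nat.cast_div_charZero hN.two_dvd, inv_div, Nat.cast_two,
    div_eq_mul_inv, sub_self]

theorem cast_succ_half_of_odd {N : ℕ} (hN : Odd N) :
    (((N + 1) / 2 : ℕ) : ℝ) = (N + 1) / 2 := by
  rw [Nat.cast_div_charZero hN.add_one.two_dvd, Nat.cast_add_one, Nat.cast_two]

theorem hasUnitExpansion_centralBinom_succ_half :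
    HasUnitExpansion oddTop (fun N : ℕ => (N : ℝ)⁻¹)
      (fun N => (((N + 1) / 2).centralBinom : ℝ) * √(Real.pi * ((N + 1) / 2 : ℕ)) /
        4 ^ ((N + 1) / 2)) (-(1 / 4)) := by
  have tendsto_half : Tendsto (fun N : ℕ => (N + 1) / 2) oddTop atTop :=
    ((Nat.tendsto_div_const_atTop two_ne_zero).comp (tendsto_add_atTop_nat 1)).mono_left
      oddTop_le_atTop
  rw [show -(1 / 4 : ℝ) = -(1 / 8) * 2 by norm_num]
  refine (hasUnitExpansion_centralBinom.comp_tendsto tendsto_half).rescale ?_ tendsto_inv_oddTop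
  refine IsBigO.of_bound 2 ?_
  filter_upwards [eventually_odd] with N hN
  have pos : (0 : ℝ) < N := Nat.cast_pos.mpr hN.pos
  have difference :
      ((N : ℝ) + 1)⁻¹ * 2 - 2 * (N : ℝ)⁻¹ = -(2 * (((N : ℝ) + 1)⁻¹ * (N : ℝ)⁻¹)) := by
    field
  rw [Function.comp_apply, cast_succ_half_of_odd hN, inv_div, div_eq_inv_mul, difference, norm_neg,
    Real.norm_of_nonneg (by positivity), Real.norm_of_nonneg (by positivity), sq]
  gcongr
  linarith

theorem momentFactor_zero_div_leadingFactor_zero_of_even {N : ℕ} (hN : Even N) (hN0 : N ≠ 0) :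
    momentFactor N 0 / leadingFactor N 0 =
      Stirling.stirlingSeq N / √Real.pi * (1 + 1 * (N : ℝ)⁻¹) *
        (((N / 2).centralBinom : ℝ) * √(Real.pi * (N / 2 : ℕ)) / 4 ^ (N / 2)) := by
  have sqrt_eq : √(2 * (N : ℝ)) = 2 * √((N / 2 : ℕ) : ℝ) := by
    rw [Nat.cast_div_charZero hN.two_dvd, Nat.cast_two,
      show 2 * (N : ℝ) = 2 ^ 2 * (N / 2) by ring, Real.sqrt_mul (by positivity),
      Real.sqrt_sq two_pos.le]
  have pow_eq : (2 : ℝ) ^ N = 4 ^ (N / 2) := by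
    rw [show (4 : ℝ) = 2 ^ 2 by norm_num, ← pow_mul, Nat.mul_div_cancel' hN.two_dvd]
  rw [momentFactor_zero_of_even hN, mul_div_right_comm,
    factorial_mul_succ_div_leadingFactor_zero hN0, sqrt_eq, pow_succ, pow_eq,
    Real.sqrt_mul Real.pi_pos.le, one_mul]
  field

theorem momentFactor_zero_div_leadingFactor_zero_of_odd {N : ℕ} (hN : Odd N) :
    momentFactor N 0 / leadingFactor N 0 =
      Stirling.stirlingSeq N / √Real.pi * √(1 + 1 * (N : ℝ)⁻¹) *
        ((((N + 1) / 2).centralBinom : ℝ) * √(Real.pi * ((N + 1) / 2 : ℕ)) /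
          4 ^ ((N + 1) / 2)) := by
  have pos : (0 : ℝ) < N := Nat.cast_pos.mpr hN.pos
  have sqrt_eq : √(((N + 1) / 2 : ℕ) : ℝ) = √(2 * (N : ℝ)) * √(1 + (N : ℝ)⁻¹) / 2 := by
    rw [eq_div_iff two_ne_zero, cast_succ_half_of_odd hN, ← Real.sqrt_mul (by positivity),
      show 2 * (N : ℝ) * (1 + (N : ℝ)⁻¹) = (N + 1) / 2 * 2 ^ 2 by field,
      Real.sqrt_mul (by positivity), Real.sqrt_sq two_pos.le]
  have pow_eq : (2 : ℝ) ^ (N + 1) = 4 ^ ((N + 1) / 2) := by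
    rw [show (4 : ℝ) = 2 ^ 2 by norm_num, ← pow_mul, Nat.mul_div_cancel' hN.add_one.two_dvd]
  have sq_sqrt : √(1 + (N : ℝ)⁻¹) ^ 2 = 1 + (N : ℝ)⁻¹ := Real.sq_sqrt (by positivity)
  rw [momentFactor_zero_of_odd hN, mul_div_right_comm,
    factorial_mul_succ_div_leadingFactor_zero hN.pos.ne', pow_eq, Real.sqrt_mul Real.pi_pos.le,
    sqrt_eq, one_mul]
  conv_lhs => rw [← sq_sqrt]
  field

theorem hasUnitExpansion_momentFactor_zero_even :
    HasUnitExpansion evenTop (fun N : ℕ => (N : ℝ)⁻¹)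
      (fun N => momentFactor N 0 / leadingFactor N 0) (5 / 6) := by
  have product := ((hasUnitExpansion_stirlingSeq.mono evenTop_le_atTop).mul
    (.one_add_mul _ _ 1) tendsto_inv_evenTop).mul hasUnitExpansion_centralBinom_half
      tendsto_inv_evenTop
  rw [show (1 / 12 + 1 + -(1 / 4) : ℝ) = 5 / 6 by norm_num] at product
  refine product.congr' ?_
  filter_upwards [eventually_even, evenTop_le_atTop (eventually_ne_atTop 0)] with N hN hN0
  exact (momentFactor_zero_div_leadingFactor_zero_of_even hN hN0).symm

theorem hasUnitExpansion_momentFactor_zero_odd :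
    HasUnitExpansion oddTop (fun N : ℕ => (N : ℝ)⁻¹)
      (fun N => momentFactor N 0 / leadingFactor N 0) (1 / 3) := by
  have product := ((hasUnitExpansion_stirlingSeq.mono oddTop_le_atTop).mul
    ((HasUnitExpansion.one_add_mul _ _ 1).sqrt tendsto_inv_oddTop) tendsto_inv_oddTop).mul
      hasUnitExpansion_centralBinom_succ_half tendsto_inv_oddTop
  rw [show (1 / 12 + 1 / 2 + -(1 / 4) : ℝ) = 1 / 3 by norm_num] at product
  refine product.congr' ?_
  filter_upwards [eventually_odd] with N hN
  exact (momentFactor_zero_div_leadingFactor_zero_of_odd hN).symm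

theorem momentFactor_succ_div_leadingFactor_succ {N : ℕ} (hN : N ≠ 0) (j : ℕ) :
    momentFactor N (j + 1) / leadingFactor N (j + 1) = momentFactor N j / leadingFactor N j *
      ((N + (2 * j + 1)) / N * (((N + (2 * j + 2)) / N) * ((N + (2 * j + 2)) / N)) *
          ((N + (2 * j + 3)) / N) /
        (4 * ((N / 2 : ℕ) + (j + 1)) * (((N + 1) / 2 : ℕ) + (j + 1)) / N ^ 2)) := by
  have pow_succ_eq : (2 * (N : ℝ)) ^ (N + (2 * (j + 1) + 1)) =
      (2 * N) ^ (N + (2 * j + 1)) * (4 * N ^ 2) := by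
    ring
  have : ((N / 2 : ℕ) : ℝ) + (j + 1) ≠ 0 := by positivity
  simp only [momentFactor, leadingFactor, pow_succ_eq]
  simp only [mul_add_one, ← add_assoc, Nat.factorial_succ]
  push_cast
  field_simp
  ring

theorem hasUnitExpansion_add_div (a : ℝ) :
    HasUnitExpansion atTop (fun N : ℕ => (N : ℝ)⁻¹) (fun N => (N + a) / N) a := by
  refine (HasUnitExpansion.one_add_mul _ _ a).congr' ?_
  filter_upwards [eventually_ne_atTop 0] with N hN
  field

theorem hasUnitExpansion_half_add_mul_half_add (a : ℝ) :
    HasUnitExpansion atTop (fun N : ℕ => (N : ℝ)⁻¹)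
      (fun N => 4 * ((N / 2 : ℕ) + a) * (((N + 1) / 2 : ℕ) + a) / N ^ 2) (4 * a) := by
  refine IsBigO.of_bound (4 * a ^ 2 + 1) ?_
  filter_upwards [eventually_ne_atTop 0] with N hN
  have half_add_half : ((N / 2 : ℕ) : ℝ) + ((N + 1) / 2 : ℕ) = N := by
    norm_cast
    omega
  have half_sub_half : |(((N + 1) / 2 : ℕ) : ℝ) - (N / 2 : ℕ)| ≤ 1 := by
    rw [abs_le]
    constructor <;> [rw [neg_le_sub_iff_le_add]; rw [sub_le_iff_le_add]] <;> norm_cast <;> omega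
  have remainder : 4 * (((N / 2 : ℕ) : ℝ) + a) * (((N + 1) / 2 : ℕ) + a) / N ^ 2 -
      (1 + 4 * a * (N : ℝ)⁻¹) =
        (4 * a ^ 2 - ((((N + 1) / 2 : ℕ) : ℝ) - (N / 2 : ℕ)) ^ 2) * (N : ℝ)⁻¹ ^ 2 := by
    field_simp
    linear_combination (((N / 2 : ℕ) : ℝ) + ((N + 1) / 2 : ℕ) + N + 4 * a) * half_add_half
  rw [remainder, norm_mul]
  gcongr
  refine (norm_sub_le _ _).trans ?_
  rw [Real.norm_of_nonneg (by positivity), norm_pow, Real.norm_eq_abs]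
  gcongr
  exact pow_le_one₀ (abs_nonneg _) half_sub_half

theorem hasUnitExpansion_momentFactor {l : Filter ℕ} (hl : l ≤ atTop) {c : ℝ}
    (h_zero : HasUnitExpansion l (fun N : ℕ => (N : ℝ)⁻¹)
      (fun N => momentFactor N 0 / leadingFactor N 0) c) (j : ℕ) :
    HasUnitExpansion l (fun N : ℕ => (N : ℝ)⁻¹)
      (fun N => momentFactor N j / leadingFactor N j) (c + 2 * j * (j + 1)) := by
  have hε := tendsto_inv_atTop_nhds_zero_nat (𝕜 := ℝ)
  induction j with
  | zero => simpa using h_zero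
  | succ j ih =>
    have shift (a : ℝ) := hasUnitExpansion_add_div a
    have step := (((shift (2 * j + 1)).mul ((shift (2 * j + 2)).mul (shift (2 * j + 2)) hε) hε).mul
      (shift (2 * j + 3)) hε).div (hasUnitExpansion_half_add_mul_half_add (j + 1)) hε
    have product := (ih.mul (step.mono hl) (hε.mono_left hl)).congr' <|
      hl ((eventually_ne_atTop 0).mono fun N hN =>
        (momentFactor_succ_div_leadingFactor_succ hN j).symm)
    convert product using 1
    push_cast
    ring

theorem hasUnitExpansion_prod_momentFactor {l : Filter ℕ} (hl : l ≤ atTop) {c : ℝ}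
    (h_zero : HasUnitExpansion l (fun N : ℕ => (N : ℝ)⁻¹)
      (fun N => momentFactor N 0 / leadingFactor N 0) c) (p : ℕ) :
    HasUnitExpansion l (fun N : ℕ => (N : ℝ)⁻¹)
      (fun N => ∏ j ∈ Finset.range p, momentFactor N j / leadingFactor N j)
      (c * p + 2 * (p ^ 3 - p) / 3) := by
  have sum_coeff : ∑ j ∈ Finset.range p, (c + 2 * (j : ℝ) * (j + 1)) =
      c * p + 2 * (p ^ 3 - p) / 3 := by
    induction p with
    | zero => simp
    | succ p ih =>
      rw [Finset.sum_range_succ, ih]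
      push_cast
      ring
  rw [← sum_coeff]
  exact .prod (fun j _ => hasUnitExpansion_momentFactor hl h_zero j)
    (tendsto_inv_atTop_nhds_zero_nat.mono_left hl)

theorem hasUnitExpansion_prod_momentFactor_even (p : ℕ) :
    HasUnitExpansion evenTop (fun N : ℕ => (N : ℝ)⁻¹)
      (fun N => ∏ j ∈ Finset.range p, momentFactor N j / leadingFactor N j)
      (p / 6 * (4 * p ^ 2 + 1)) := by
  convert hasUnitExpansion_prod_momentFactor evenTop_le_atTop
    hasUnitExpansion_momentFactor_zero_even p using 1
  ring

theorem hasUnitExpansion_prod_momentFactor_odd (p : ℕ) :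
    HasUnitExpansion oddTop (fun N : ℕ => (N : ℝ)⁻¹)
      (fun N => ∏ j ∈ Finset.range p, momentFactor N j / leadingFactor N j)
      (p / 3 * (2 * p ^ 2 - 1)) := by
  convert hasUnitExpansion_prod_momentFactor oddTop_le_atTop
    hasUnitExpansion_momentFactor_zero_odd p using 1
  ring

theorem hasUnitExpansion_Cpart_mul_De (p : ℕ) :
    HasUnitExpansion evenTop (fun N : ℕ => (N : ℝ)⁻¹)
      (fun N => Cpart (rectPart N (2 * p)) (2 * p) * De p N /
        (Real.exp (-((N : ℝ) * p)) * (2 * (N : ℝ)) ^ (N * p + p ^ 2) * gammaConst p))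
      (p / 6 * (4 * p ^ 2 + 1)) := by
  refine (hasUnitExpansion_prod_momentFactor_even p).congr' ?_
  filter_upwards [eventually_even] with N hN
  rw [Cpart_mul_De hN, Finset.prod_div_distrib, prod_leadingFactor]

theorem hasUnitExpansion_Cpart_mul_Do (p : ℕ) :
    HasUnitExpansion oddTop (fun N : ℕ => (N : ℝ)⁻¹)
      (fun N => Cpart (rectPart N (2 * p)) (2 * p) * Do p N /
        ((-1) ^ p * Real.exp (-((N : ℝ) * p)) * (2 * (N : ℝ)) ^ (N * p + p ^ 2) * gammaConst p))
      (p / 3 * (2 * p ^ 2 - 1)) := by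
  have sign_ne_zero : (-1 : ℝ) ^ p ≠ 0 := pow_ne_zero p (by norm_num)
  refine (hasUnitExpansion_prod_momentFactor_odd p).congr' ?_
  filter_upwards [eventually_odd] with N hN
  rw [Cpart_mul_Do hN, Finset.prod_div_distrib, prod_leadingFactor]
  simp only [mul_assoc, mul_div_mul_left _ _ sign_ne_zero]

theorem gueDetMoment_div_leadingTerm {N : ℕ} (hN : 0 < N) (p : ℕ) :
    gueDetMoment N (2 * p) / (leadingTerm p N : ℂ) =
      ((∏ j ∈ Finset.range p, momentFactor N j / leadingFactor N j : ℝ) : ℂ) := by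
  rw [gueDetMoment_eq_prod_momentFactor hN, ← Complex.ofReal_div, Finset.prod_div_distrib,
    prod_leadingFactor, div_div, leadingTerm, pow_add]
  ring_nf

theorem isBigO_gueDetMoment_div_leadingTerm_sub {l : Filter ℕ} (hl : l ≤ atTop) {p : ℕ} {c : ℝ}
    (h : HasUnitExpansion l (fun N : ℕ => (N : ℝ)⁻¹)
      (fun N => ∏ j ∈ Finset.range p, momentFactor N j / leadingFactor N j) c) :
    (fun N : ℕ => gueDetMoment N (2 * p) / (leadingTerm p N : ℂ) -
      ((1 + c * (N : ℝ)⁻¹ : ℝ) : ℂ)) =O[l] fun N : ℕ => (N : ℝ)⁻¹ ^ 2 := by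
  refine (Complex.isBigO_ofReal_left.mpr h).congr' ?_ EventuallyEq.rfl
  filter_upwards [hl (eventually_gt_atTop 0)] with N hN
  rw [gueDetMoment_div_leadingTerm hN, Complex.ofReal_sub]

theorem gueDetMoment_isEquivalent_leadingTerm (p : ℕ) :
    (fun N : ℕ => gueDetMoment N (2 * p)) ~[atTop] fun N : ℕ => (leadingTerm p N : ℂ) := by
  have tendsto_one := ((hasUnitExpansion_prod_momentFactor_even p).tendsto_one
    tendsto_inv_evenTop).sup ((hasUnitExpansion_prod_momentFactor_odd p).tendsto_one
      tendsto_inv_oddTop)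
  rw [evenTop_sup_oddTop] at tendsto_one
  refine isEquivalent_of_tendsto_one ?_
  have tendsto_ofReal := (Complex.continuous_ofReal.tendsto 1).comp tendsto_one
  rw [Complex.ofReal_one] at tendsto_ofReal
  refine tendsto_ofReal.congr' ?_
  filter_upwards [eventually_gt_atTop 0] with N hN
  exact (gueDetMoment_div_leadingTerm hN p).symm

theorem brezinHikami_zero (p N : ℕ) : brezinHikami p N 0 = leadingTerm p N := by
  have sqrt_four : √(4 : ℝ) = 2 := by
    rw [show (4 : ℝ) = 2 ^ 2 by norm_num, Real.sqrt_sq two_pos.le]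
  have density : 2 * Real.pi * N * rhoSC 0 = 2 * (N : ℝ) := by
    rw [rhoSC, zero_pow two_ne_zero, sub_zero, sqrt_four]
    field
  rw [brezinHikami, leadingTerm, density, zero_pow two_ne_zero, mul_zero, zero_div, Real.exp_zero,
    mul_one]

end Asymptotics

end

theorem mainTheorem2 (p : ℕ) :
    -- the exact formula for every finite `N`
    (∀ N : ℕ, 1 ≤ N →
      Integrable (fun ω => (gueMatrix N ω).det ^ (2 * p)) (gueProb N) ∧
      (Even N → gueDetMoment N (2 * p) =
        (((-(1 / (2 * (N : ℝ)))) ^ (N * p) * (Cpart (rectPart N (2 * p)) (2 * p) * De p N) : ℝ) : ℂ)) ∧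
      (Odd N → gueDetMoment N (2 * p) =
        (((-(1 / (2 * (N : ℝ)))) ^ (N * p) * (Cpart (rectPart N (2 * p)) (2 * p) * Do p N) : ℝ) : ℂ))) ∧
    -- the expansions of `C D_e` and `C D_o`
    ((fun N : ℕ => Cpart (rectPart N (2 * p)) (2 * p) * De p N /
          (Real.exp (-((N : ℝ) * p)) * (2 * (N : ℝ)) ^ (N * p + p ^ 2) * gammaConst p)
        - (1 + (p : ℝ) / (6 * N) * (4 * (p : ℝ) ^ 2 + 1)))
      =O[evenTop] fun N : ℕ => 1 / (N : ℝ) ^ 2) ∧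
    ((fun N : ℕ => Cpart (rectPart N (2 * p)) (2 * p) * Do p N /
          ((-1) ^ p * Real.exp (-((N : ℝ) * p)) * (2 * (N : ℝ)) ^ (N * p + p ^ 2) * gammaConst p)
        - (1 + (p : ℝ) / (3 * N) * (2 * (p : ℝ) ^ 2 - 1)))
      =O[oddTop] fun N : ℕ => 1 / (N : ℝ) ^ 2) ∧
    -- the leading order of the moments, which is the Brézin–Hikami expression at `t = 0`
    ((fun N : ℕ => gueDetMoment N (2 * p)) ~[atTop] fun N : ℕ => ((leadingTerm p N : ℝ) : ℂ)) ∧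
    (∀ N : ℕ, brezinHikami p N 0 = leadingTerm p N) ∧
    -- the `1 / N` corrections to the moments
    ((fun N : ℕ => gueDetMoment N (2 * p) / ((leadingTerm p N : ℝ) : ℂ)
        - ((1 + (p : ℝ) / (6 * N) * (4 * (p : ℝ) ^ 2 + 1) : ℝ) : ℂ))
      =O[evenTop] fun N : ℕ => 1 / (N : ℝ) ^ 2) ∧
    ((fun N : ℕ => gueDetMoment N (2 * p) / ((leadingTerm p N : ℝ) : ℂ)
        - ((1 + (p : ℝ) / (3 * N) * (2 * (p : ℝ) ^ 2 - 1) : ℝ) : ℂ))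
      =O[oddTop] fun N : ℕ => 1 / (N : ℝ) ^ 2) := by
  have coeff_even (N : ℕ) : (p : ℝ) / (6 * N) * (4 * (p : ℝ) ^ 2 + 1) =
      p / 6 * (4 * p ^ 2 + 1) * (N : ℝ)⁻¹ := by
    ring
  have coeff_odd (N : ℕ) : (p : ℝ) / (3 * N) * (2 * (p : ℝ) ^ 2 - 1) =
      p / 3 * (2 * p ^ 2 - 1) * (N : ℝ)⁻¹ := by
    ring
  have error_scale (N : ℕ) : 1 / (N : ℝ) ^ 2 = (N : ℝ)⁻¹ ^ 2 := by
    rw [one_div, inv_pow]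
  simp only [coeff_even, coeff_odd, error_scale]
  exact ⟨fun N hN => ⟨integrable_gueMatrix_det_pow hN (2 * p),
      fun h_even => gueDetMoment_of_even hN h_even p, fun h_odd => gueDetMoment_of_odd hN h_odd p⟩,
    hasUnitExpansion_Cpart_mul_De p, hasUnitExpansion_Cpart_mul_Do p,
    gueDetMoment_isEquivalent_leadingTerm p, brezinHikami_zero p,
    isBigO_gueDetMoment_div_leadingTerm_sub evenTop_le_atTop
      (hasUnitExpansion_prod_momentFactor_even p),
    isBigO_gueDetMoment_div_leadingTerm_sub oddTop_le_atTop
      (hasUnitExpansion_prod_momentFactor_odd p)⟩
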